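/- **Theorem 1.3.** Let $n\ge 5$, let $\mathcal P_n\subset\mathbb R[x]$ be the space of real polynomials of degree at most $n$, and let $M\subset\mathcal P_n$ be a subspace of codimension one. For a subspace $W$ of $\mathbb R[x]$, let $\mathcal D_2(W)$ denote the vector space of linear differential operators $T=p(x)D_{xx}+q(x)D_x+r(x)$ of order at most two with coefficients $p,q,r\in\mathbb R(x)$ such that $T(W)\subset W$. Call $M$ *exceptional* if $\mathcal D_2(M)\not\subset\mathcal D_2(\mathcal P_n)$. Two subspaces of $\mathcal P_n$ are *projectively equivalent* if one is carried onto the other by a transformation $$P(x)\mapsto(\gamma x+\delta)^n\,P\!\left(\frac{\alpha x+\beta}{\gamma x+\delta}\right),\qquad \begin{pmatrix}\alpha&\beta\\ \gamma&\delta\end{pmatrix}\in \mathrm{SL}(2,\mathbb R).$$ (a) If $M$ is exceptional and is not projectively equivalent to $\mathcal P_{n-1}$, then $M$ is projectively equivalent to $\langle x+1,x^2,x^3,\dots,x^n\rangle$. (b) Let $p_i=\sum_{j=0}^n p_{ij}x^j$ $(i=1,\dots,n)$ be any basis of $M$, and let $q_M\in\mathcal P_n$ be the determinant of the $(n+1)\times(n+1)$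 matrix whose $i$-th row is $(p_{i0},p_{i1},\dots,p_{in})$ for $i\le n$ and whose last row has entries $(-1)^j\binom nj x^{n-j}$, $0\le j\le n$ (a change of basis only multiplies $q_M$ by a nonzero constant; the line it spans is the fundamental covariant of $M$). If every root of $q_M$ in $\mathbb R\cup\{\infty\}$ has multiplicity at most $n-2$, where the multiplicity of the root $\infty$ is $n-\deg q_M$, then $\mathcal D_2(M)\subset\mathcal D_2(\mathcal P_n)$. -/

import Mathlib

open Polynomial

namespace Exceptional

noncomputable section

/-- `P n`: the real polynomials of degree at most `n`. -/
abbrev P (n : ℕ) : Submodule ℝ ℝ[X] := Polynomial.degreeLE ℝ (n : WithBot ℕ)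

/-- A differential operator `p D² + q D + r` of order at most two with rational coefficients,
given by the triple `(p, q, r)`. -/
abbrev RatOp : Type := RatFunc ℝ × RatFunc ℝ × RatFunc ℝ

/-- `T(y) = p y'' + q y' + r y` for a polynomial `y`; the result is a rational function. -/
def RatOp.apply (T : RatOp) (y : ℝ[X]) : RatFunc ℝ :=
  T.1 * algebraMap ℝ[X] (RatFunc ℝ) (derivative (derivative y))
    + T.2.1 * algebraMap ℝ[X] (RatFunc ℝ) (derivative y)
    + T.2.2 * algebraMap ℝ[X] (RatFunc ℝ) y

/-- `D2 M`: the vector space of operators `T` of order at most two with rational coefficients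
such that `T(M) ⊆ M`. -/
def D2 (M : Submodule ℝ ℝ[X]) : Submodule ℝ RatOp where
  carrier := {T | ∀ y ∈ M, ∃ z ∈ M, T.apply y = algebraMap ℝ[X] (RatFunc ℝ) z}
  zero_mem' := fun y _ => ⟨0, M.zero_mem, by simp [RatOp.apply]⟩
  add_mem' := by
    intro S T hS hT y hy
    obtain ⟨z, hz, hSz⟩ := hS y hy
    obtain ⟨w, hw, hTw⟩ := hT y hy
    refine ⟨z + w, M.add_mem hz hw, ?_⟩
    rw [map_add, ← hSz, ← hTw]
    simp only [RatOp.apply, Prod.fst_add, Prod.snd_add]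
    ring
  smul_mem' := by
    intro c T hT y hy
    obtain ⟨z, hz, hTz⟩ := hT y hy
    refine ⟨c • z, M.smul_mem c hz, ?_⟩
    have h : algebraMap ℝ[X] (RatFunc ℝ) (c • z) = c • algebraMap ℝ[X] (RatFunc ℝ) z :=
      map_smul (IsScalarTower.toAlgHom ℝ ℝ[X] (RatFunc ℝ)) c z
    rw [h, ← hTz]
    simp only [RatOp.apply, Prod.smul_fst, Prod.smul_snd, smul_mul_assoc, smul_add]

/-- A subspace `M ⊆ P n` is exceptional if `D2 M` is not contained in `D2 (P n)`. -/
def IsExceptional (n : ℕ) (M : Submodule ℝ ℝ[X]) : Prop := ¬ D2 M ≤ D2 (P n)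

/-- The projective action of `A = !![α, β; γ, δ]` on polynomials of degree at most `n`,
`y ↦ (γ x + δ)^n * y((α x + β) / (γ x + δ))`, with denominators cleared; see `eval_slAct`. -/
def slAct (n : ℕ) (A : Matrix.SpecialLinearGroup (Fin 2) ℝ) : ℝ[X] →ₗ[ℝ] ℝ[X] :=
  ∑ k ∈ Finset.range (n + 1),
    (Polynomial.lcoeff ℝ k).smulRight
      ((C (A.1 0 0) * X + C (A.1 0 1)) ^ k * (C (A.1 1 0) * X + C (A.1 1 1)) ^ (n - k))

theorem eval_slAct (n : ℕ) (A : Matrix.SpecialLinearGroup (Fin 2) ℝ) (y : ℝ[X]) (hy : y ∈ P n)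
    (x : ℝ) (hx : A.1 1 0 * x + A.1 1 1 ≠ 0) :
    (slAct n A y).eval x = (A.1 1 0 * x + A.1 1 1) ^ n *
      y.eval ((A.1 0 0 * x + A.1 0 1) / (A.1 1 0 * x + A.1 1 1)) := by
  have hdeg : y.natDegree < n + 1 :=
    Nat.lt_succ_of_le (natDegree_le_iff_degree_le.2 (mem_degreeLE.1 hy))
  rw [eval_eq_sum_range' hdeg, Finset.mul_sum]
  simp only [slAct, LinearMap.sum_apply, LinearMap.smulRight_apply, lcoeff_apply, eval_finsetSum,
    eval_smul, eval_mul, eval_pow, eval_add, eval_C, eval_X, smul_eq_mul]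
  refine Finset.sum_congr rfl fun k hk => ?_
  have hk' : k ≤ n := Nat.lt_succ_iff.1 (Finset.mem_range.1 hk)
  have hpow : (A.1 1 0 * x + A.1 1 1) ^ n =
      (A.1 1 0 * x + A.1 1 1) ^ (n - k) * (A.1 1 0 * x + A.1 1 1) ^ k := by
    rw [← pow_add, Nat.sub_add_cancel hk']
  have hne := pow_ne_zero k hx
  rw [div_pow, hpow, mul_div_assoc', mul_div_assoc', eq_div_iff hne]
  ring

/-- Projective equivalence of subspaces of `P n`: some element of `SL(2, ℝ)` carries `M` onto
`N`. -/
def ProjEquiv (n : ℕ) (M N : Submodule ℝ ℝ[X]) : Prop :=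
  ∃ A : Matrix.SpecialLinearGroup (Fin 2) ℝ, M.map (slAct n A) = N

/-- The subspace `⟨x + 1, x², x³, …, xⁿ⟩`. -/
def E (n : ℕ) : Submodule ℝ ℝ[X] :=
  Submodule.span ℝ (insert (X + 1) ((fun k : ℕ => (X : ℝ[X]) ^ k) '' Set.Icc 2 n))

/-- The fundamental covariant of the codimension one subspace of `P n` with basis `p`: the
determinant whose first `n` rows are the coefficients of the `p i` and whose last row has the
entries `(-1)^j * (n choose j) * x^(n-j)`. A change of basis multiplies it by a nonzero
constant. -/
def covariant (n : ℕ) (p : Fin n → ℝ[X]) : ℝ[X] :=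
  Matrix.det (Matrix.of (Fin.snoc (α := fun _ => Fin (n + 1) → ℝ[X])
    (fun i j => C ((p i).coeff j))
    (fun j => C ((-1 : ℝ) ^ (j : ℕ) * (n.choose j : ℝ)) * X ^ (n - (j : ℕ)))))

/-- All roots of `q`, seen as a form of degree `n`, on the real projective line have multiplicity
at most `m`; the multiplicity of the root at infinity is `n - deg q`. -/
def RootMultLE (n m : ℕ) (q : ℝ[X]) : Prop :=
  (∀ x : ℝ, q.rootMultiplicity x ≤ m) ∧ n - q.natDegree ≤ m

end

end Exceptional

/-!
# Exceptional subspaces of codimension one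

Write `M = P n ∩ ker φ` and let `T` be an operator of order at most two that preserves `M` but not
`P n`. Choose `v ∈ P n` with `φ v = 1` and put `f = T v`, which does not lie in `P n`. Then
`T y ≡ φ(y) f` modulo `P n` for all `y ∈ P n`. The third commutator of `T` with multiplication by
`x` vanishes, so for `y` of degree at most `n - 3` the cubic `g_y(x) = φ((t - x)³ y(t))` satisfies
`g_y f ∈ P (n + 3)` (`exists_cubeForm_mul`). Two cases arise.

* If `f` is not a polynomial, let `ξ ∈ ℂ` be one of its poles. All `g_y` vanish at `ξ`, that is,
  `φ` kills `(t - ξ)³ P (n - 3)`. For non-real `ξ` it also kills the conjugate space, and for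
  `n ≥ 5` the two span everything (`eq_zero_of_nonreal`). So `ξ` is real and `φ` is a combination
  of `y(ξ)`, `y'(ξ)`, `y''(ξ)`. If `y''(ξ)` occurred, the pole would be simple and the expansion of
  `T (x - ξ)⁵ ∈ M` at `ξ` would start with a nonzero multiple of `(x - ξ)²`, contradicting
  `φ = 0` on `M` (`functional_sq_eq_zero_of_pole`).
* If `f` is a polynomial of degree greater than `n`, the same argument at infinity, with
  `T x^(n-5) ∈ M`, shows that `φ` depends only on the two top coefficients
  (`functional_eq_zero_of_polynomial`).

Hence the functional defining an exceptional hyperplane is a first order jet at a point of the real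
projective line (`IsExceptional.exists_jet`). If the jet is of order zero, a projective
transformation carries `M` to `P (n - 1)`; otherwise one carries it to `E n`, which is cut out by
`y(0) = y'(0)`. On the other hand the fundamental covariant is, up to a constant,
`φ_t((x - t)^n)` (`eval_covariant`, `detFunctional_eq_mul`), so for a first order jet it is zero or
has a root of multiplicity at least `n - 1`.
-/

namespace Exceptional

/-! ### Polynomials of bounded degree and functionals on them -/

theorem mem_P {n : ℕ} {y : ℝ[X]} : y ∈ P n ↔ y.natDegree ≤ n := by
  rw [mem_degreeLE, natDegree_le_iff_degree_le]

theorem exists_eq_C_add_mul {n : ℕ} (ξ : ℝ) {y : ℝ[X]} (hy : y ∈ P (n + 1)) :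
    ∃ u ∈ P n, y = C (y.eval ξ) + (X - C ξ) * u := by
  refine ⟨y /ₘ (X - C ξ), ?_, ?_⟩
  · rw [mem_P] at hy ⊢
    rw [natDegree_divByMonic _ (monic_X_sub_C ξ), natDegree_X_sub_C]
    omega
  · rw [← modByMonic_X_sub_C_eq_C_eval, modByMonic_add_div]

theorem X_sub_C_mul_mem {n : ℕ} (ξ : ℝ) {y : ℝ[X]} (hy : y ∈ P n) :
    (X - C ξ) * y ∈ P (n + 1) := by
  rw [mem_P] at hy ⊢
  refine natDegree_mul_le.trans ?_
  rw [natDegree_X_sub_C]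
  omega

theorem X_sub_C_pow_mul_mem {n : ℕ} (ξ : ℝ) (k : ℕ) {y : ℝ[X]} (hy : y ∈ P n) :
    (X - C ξ) ^ k * y ∈ P (n + k) := by
  rw [mem_P] at hy ⊢
  refine natDegree_mul_le.trans ?_
  rw [natDegree_pow, natDegree_X_sub_C]
  omega

theorem P_mono {m n : ℕ} (h : m ≤ n) : P m ≤ P n := fun _ hy =>
  mem_P.2 ((mem_P.1 hy).trans h)

theorem functional_C_mul (φ : ℝ[X] →ₗ[ℝ] ℝ) (c : ℝ) (y : ℝ[X]) : φ (C c * y) = c * φ y := by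
  rw [← smul_eq_C_mul, map_smul, smul_eq_mul]

/-! ### Commutator identities for operators of order two -/

namespace RatOp

theorem apply_add (T : RatOp) (y z : ℝ[X]) : T.apply (y + z) = T.apply y + T.apply z := by
  simp only [RatOp.apply, map_add]
  ring

theorem apply_C_mul (T : RatOp) (c : ℝ) (y : ℝ[X]) :
    T.apply (C c * y) = algebraMap ℝ[X] (RatFunc ℝ) (C c) * T.apply y := by
  simp only [RatOp.apply, derivative_C_mul, map_mul]
  ring

/-- The third commutator of an operator of order at most two with multiplication by `X - C ξ`
vanishes. -/
theorem commutator_cube (T : RatOp) (ξ : ℝ) (y : ℝ[X]) :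
    T.apply ((X - C ξ) ^ 3 * y)
      - 3 * algebraMap ℝ[X] (RatFunc ℝ) (X - C ξ) * T.apply ((X - C ξ) ^ 2 * y)
      + 3 * algebraMap ℝ[X] (RatFunc ℝ) (X - C ξ) ^ 2 * T.apply ((X - C ξ) * y)
      - algebraMap ℝ[X] (RatFunc ℝ) (X - C ξ) ^ 3 * T.apply y = 0 := by
  have hL : derivative (X - C ξ) = 1 := by simp
  generalize X - C ξ = L at hL ⊢
  simp only [RatOp.apply, derivative_mul, derivative_pow, map_add, map_mul, map_pow, hL,
    derivative_one, map_one, mul_one,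
    Nat.cast_ofNat, Nat.add_one_sub_one, map_ofNat, derivative_ofNat, pow_one,
    zero_mul, zero_add]
  ring

/-- For `L = X - C ξ`, the function `k ↦ L⁻ᵏ T(Lᵏ y)` is polynomial of degree at most two in `k`;
this is its extrapolation from `0, 1, 2` to `5`. -/
theorem apply_pow_five (T : RatOp) (ξ : ℝ) (y : ℝ[X]) :
    T.apply ((X - C ξ) ^ 5 * y) =
      10 * algebraMap ℝ[X] (RatFunc ℝ) (X - C ξ) ^ 3 * T.apply ((X - C ξ) ^ 2 * y)
      - 15 * algebraMap ℝ[X] (RatFunc ℝ) (X - C ξ) ^ 4 * T.apply ((X - C ξ) * y)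
      + 6 * algebraMap ℝ[X] (RatFunc ℝ) (X - C ξ) ^ 5 * T.apply y := by
  have hL : derivative (X - C ξ) = 1 := by simp
  generalize X - C ξ = L at hL ⊢
  simp only [RatOp.apply, derivative_mul, derivative_pow, map_add, map_mul, map_pow, hL,
    derivative_one, map_one, mul_one,
    Nat.cast_ofNat, Nat.add_one_sub_one, map_ofNat, derivative_ofNat, pow_one,
    zero_mul, zero_add]
  ring

/-- The extrapolation of `k ↦ L⁻ᵏ T(Lᵏ y)`, with `L = X - C ξ`, from `3, 4, 5` to `0`. -/
theorem pow_five_mul_apply (T : RatOp) (ξ : ℝ) (y : ℝ[X]) :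
    algebraMap ℝ[X] (RatFunc ℝ) (X - C ξ) ^ 5 * T.apply y =
      6 * T.apply ((X - C ξ) ^ 5 * y)
      - 15 * algebraMap ℝ[X] (RatFunc ℝ) (X - C ξ) * T.apply ((X - C ξ) ^ 4 * y)
      + 10 * algebraMap ℝ[X] (RatFunc ℝ) (X - C ξ) ^ 2 * T.apply ((X - C ξ) ^ 3 * y) := by
  have hL : derivative (X - C ξ) = 1 := by simp
  generalize X - C ξ = L at hL ⊢
  simp only [RatOp.apply, derivative_mul, derivative_pow, map_add, map_mul, map_pow, hL,
    mul_one,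
    Nat.cast_ofNat, Nat.add_one_sub_one, map_ofNat, derivative_ofNat, pow_one,
    zero_mul, zero_add]
  ring

end RatOp

/-! ### The functional and the image of a complementary vector -/

/-- The cubic `x ↦ φ((t - x)³ y(t))`, where `φ` acts on polynomials in `t`, expanded in powers of
`x - ξ`. -/
noncomputable def cubeForm (φ : ℝ[X] →ₗ[ℝ] ℝ) (ξ : ℝ) (y : ℝ[X]) : ℝ[X] :=
  C (φ ((X - C ξ) ^ 3 * y)) - 3 * (X - C ξ) * C (φ ((X - C ξ) ^ 2 * y))
    + 3 * (X - C ξ) ^ 2 * C (φ ((X - C ξ) * y)) - (X - C ξ) ^ 3 * C (φ y)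

theorem finrank_P (n : ℕ) : Module.finrank ℝ (P n) = n + 1 := by
  rw [P, ← degreeLT_succ_eq_degreeLE, (degreeLTEquiv ℝ (n + 1)).finrank_eq, Module.finrank_fin_fun]

instance finiteDimensional_P (n : ℕ) : FiniteDimensional ℝ (P n) :=
  .of_finrank_pos (by rw [finrank_P]; omega)

theorem exists_functional {n : ℕ} {M : Submodule ℝ ℝ[X]} (hM : M ≤ P n)
    (hd : Module.finrank ℝ M = n) {v : ℝ[X]} (hv : v ∈ P n) (hvM : v ∉ M) :
    ∃ φ : ℝ[X] →ₗ[ℝ] ℝ, φ v = 1 ∧ ∀ y ∈ P n, y ∈ M ↔ φ y = 0 := by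
  obtain ⟨g, hg, hgM⟩ := Submodule.exists_le_ker_of_notMem hvM
  refine ⟨(g v)⁻¹ • g, by simp [hg], fun y hy => ?_⟩
  have hK : P n ⊓ LinearMap.ker g < P n :=
    lt_of_le_of_ne inf_le_left fun h => hg (h.ge hv).2
  have hle := Submodule.finrank_lt_finrank_of_lt hK
  rw [finrank_P] at hle
  have : FiniteDimensional ℝ (P n ⊓ LinearMap.ker g : Submodule ℝ ℝ[X]) :=
    Submodule.finiteDimensional_of_le inf_le_left
  have hMK : M = P n ⊓ LinearMap.ker g :=
    Submodule.eq_of_le_of_finrank_le (le_inf hM hgM) (by omega)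
  rw [hMK, Submodule.mem_inf, LinearMap.mem_ker]
  simp [hy, hg]

variable {n : ℕ} {M : Submodule ℝ ℝ[X]} {T : RatOp} {φ : ℝ[X] →ₗ[ℝ] ℝ} {v : ℝ[X]}

/-- Modulo `P n`, an operator preserving the hyperplane `φ = 0` acts as `y ↦ φ(y) T(v)`. -/
theorem exists_apply_eq (hM : M ≤ P n) (hT : T ∈ D2 M) (hφ : ∀ y ∈ P n, y ∈ M ↔ φ y = 0)
    (hv : v ∈ P n) (hv1 : φ v = 1) {y : ℝ[X]} (hy : y ∈ P n) :
    ∃ m ∈ P n, T.apply y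
      = algebraMap ℝ[X] (RatFunc ℝ) m + algebraMap ℝ[X] (RatFunc ℝ) (C (φ y)) * T.apply v := by
  have hz : y - C (φ y) * v ∈ P n := by
    rw [← smul_eq_C_mul]
    exact (P n).sub_mem hy ((P n).smul_mem _ hv)
  obtain ⟨m, hm, hTm⟩ := hT _ ((hφ _ hz).2
    (by rw [map_sub, functional_C_mul, hv1, mul_one, sub_self]))
  refine ⟨m, hM hm, ?_⟩
  rw [← hTm, ← RatOp.apply_C_mul, ← RatOp.apply_add, sub_add_cancel]

/-- The commutator identity modulo `P (n + 3)`: multiplication by the cubics `cubeForm φ ξ y` clears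
the denominator of `T(v)` and bounds the degree. -/
theorem exists_cubeForm_mul (hn : 3 ≤ n) (hM : M ≤ P n) (hT : T ∈ D2 M)
    (hφ : ∀ y ∈ P n, y ∈ M ↔ φ y = 0) (hv : v ∈ P n) (hv1 : φ v = 1) (ξ : ℝ) {y : ℝ[X]}
    (hy : y ∈ P (n - 3)) :
    ∃ h ∈ P (n + 3), algebraMap ℝ[X] (RatFunc ℝ) (cubeForm φ ξ y) * T.apply v
      = algebraMap ℝ[X] (RatFunc ℝ) h := by
  obtain ⟨k, rfl⟩ := Nat.exists_eq_add_of_le' hn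
  rw [Nat.add_sub_cancel] at hy
  have key {z : ℝ[X]} (hz : z ∈ P (k + 3)) := exists_apply_eq hM hT hφ hv hv1 hz
  obtain ⟨m₀, h₀, e₀⟩ := key (P_mono (by omega) hy)
  obtain ⟨m₁, h₁, e₁⟩ := key (P_mono (by omega) (X_sub_C_mul_mem ξ hy))
  obtain ⟨m₂, h₂, e₂⟩ := key (P_mono (by omega) (X_sub_C_pow_mul_mem ξ 2 hy))
  obtain ⟨m₃, h₃, e₃⟩ := key (X_sub_C_pow_mul_mem ξ 3 hy)
  refine ⟨-(m₃ - (3 : ℝ) • ((X - C ξ) ^ 1 * m₂) + (3 : ℝ) • ((X - C ξ) ^ 2 * m₁)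
    - (X - C ξ) ^ 3 * m₀), ?_, ?_⟩
  · refine neg_mem (sub_mem (add_mem (sub_mem (P_mono (by omega) h₃) ?_) ?_) ?_)
    · exact Submodule.smul_mem _ _ (P_mono (by omega) (X_sub_C_pow_mul_mem ξ 1 h₂))
    · exact Submodule.smul_mem _ _ (P_mono (by omega) (X_sub_C_pow_mul_mem ξ 2 h₁))
    · exact X_sub_C_pow_mul_mem ξ 3 h₀
  · have := T.commutator_cube ξ y
    rw [e₀, e₁, e₂, e₃] at this
    simp only [cubeForm, smul_eq_C_mul, map_ofNat, map_sub, map_add, map_mul, map_neg, map_pow]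
      at this ⊢
    linear_combination this

/-! ### A pole at a finite point -/

/-- A real functional on `P n` that kills `(X - z)³ P (n - 3)` for a non-real `z = ρ + i η`
vanishes. The hypotheses are the real and imaginary parts of `φ((X - z)³ y) = 0`. -/
theorem eq_zero_of_nonreal (hn : 5 ≤ n) {ρ η : ℝ} (hη : η ≠ 0)
    (h₁ : ∀ y ∈ P (n - 3), φ ((X - C ρ) ^ 3 * y) = 3 * η ^ 2 * φ ((X - C ρ) * y))
    (h₂ : ∀ y ∈ P (n - 3), 3 * φ ((X - C ρ) ^ 2 * y) = η ^ 2 * φ y) :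
    ∀ y ∈ P n, φ y = 0 := by
  obtain ⟨k, rfl⟩ := Nat.exists_eq_add_of_le' hn
  rw [show k + 5 - 3 = k + 2 by omega] at h₁ h₂
  -- Comparing `φ(L³ y) = 3 η² φ(L y)` with `3 φ(L² (L y)) = η² φ(L y)`, where `L = X - C ρ`,
  -- gives `8 η² φ(L y) = 0`; this costs one degree of `y`.
  have hη2 : η ^ 2 ≠ 0 := pow_ne_zero 2 hη
  have a₁ : ∀ y ∈ P (k + 1), φ ((X - C ρ) * y) = 0 := fun y hy => by
    have e₁ := h₁ y (P_mono (by omega) hy)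
    have e₂ := h₂ _ (X_sub_C_mul_mem ρ hy)
    rw [← mul_assoc, ← pow_succ] at e₂
    have : η ^ 2 * φ ((X - C ρ) * y) = 0 := by linarith
    exact (mul_eq_zero.1 this).resolve_left hη2
  have a₀ : ∀ y ∈ P k, φ y = 0 := fun y hy => by
    have e₂ := h₂ y (P_mono (by omega) hy)
    rw [pow_two, mul_assoc, a₁ _ (X_sub_C_mul_mem ρ hy), mul_zero] at e₂
    exact (mul_eq_zero.1 e₂.symm).resolve_left hη2
  have hC : ∀ c : ℝ, C c ∈ P k := fun c => mem_P.2 (by simp)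
  have a₂ : ∀ y ∈ P (k + 2), φ y = 0 := fun y hy => by
    obtain ⟨u, hu, e⟩ := exists_eq_C_add_mul ρ hy
    rw [e, map_add, a₁ u hu, a₀ _ (hC _), add_zero]
  have a₃ : ∀ y ∈ P (k + 3), φ ((X - C ρ) * y) = 0 := fun y hy => by
    obtain ⟨u, hu, e⟩ := exists_eq_C_add_mul ρ hy
    have := h₂ u hu
    rw [a₂ u hu] at this
    rw [e, mul_add, map_add, a₁ _ (P_mono (by omega) (hC _)), ← mul_assoc, ← pow_two]
    linarith
  have a₄ : ∀ y ∈ P (k + 4), φ ((X - C ρ) * y) = 0 := fun y hy => by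
    obtain ⟨u, hu, e⟩ := exists_eq_C_add_mul ρ hy
    obtain ⟨w, hw, e'⟩ := exists_eq_C_add_mul ρ hu
    have e₃ := h₁ w hw
    rw [a₃ w (P_mono (by omega) hw), mul_zero] at e₃
    have e₂ : φ ((X - C ρ) * (C (y.eval ρ) + (X - C ρ) * C (u.eval ρ))) = 0 := a₃ _ <|
      add_mem (P_mono (by omega) (hC _)) (P_mono (by omega) (X_sub_C_mul_mem ρ (hC _)))
    have : (X - C ρ) * y = (X - C ρ) * (C (y.eval ρ) + (X - C ρ) * C (u.eval ρ))
        + (X - C ρ) ^ 3 * w := by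
      conv_lhs => rw [e, e']
      ring
    rw [this, map_add, e₂, e₃, add_zero]
  intro y hy
  obtain ⟨u, hu, e⟩ := exists_eq_C_add_mul ρ hy
  rw [e, map_add, a₄ u hu, a₀ _ (hC _), add_zero]

theorem mul_num_eq_mul_denom {f : RatFunc ℝ} {g h : ℝ[X]}
    (e : algebraMap ℝ[X] (RatFunc ℝ) g * f = algebraMap ℝ[X] (RatFunc ℝ) h) :
    g * f.num = h * f.denom := by
  have hD : algebraMap ℝ[X] (RatFunc ℝ) f.denom ≠ 0 :=
    RatFunc.algebraMap_ne_zero f.denom_ne_zero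
  apply RatFunc.algebraMap_injective ℝ
  rw [← RatFunc.num_div_denom f, ← mul_div_assoc, div_eq_iff hD] at e
  rw [map_mul, map_mul, e]

/-- If `T(v)` is not a polynomial, it has a real pole `ξ`, and `φ` is a jet of order at most two
at `ξ`. -/
theorem exists_real_pole (hn : 5 ≤ n) (hM : M ≤ P n) (hT : T ∈ D2 M)
    (hφ : ∀ y ∈ P n, y ∈ M ↔ φ y = 0) (hv : v ∈ P n) (hv1 : φ v = 1)
    (hf : ∀ F : ℝ[X], T.apply v ≠ algebraMap ℝ[X] (RatFunc ℝ) F) :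
    ∃ ξ : ℝ, (T.apply v).denom.IsRoot ξ ∧ ∀ y ∈ P (n - 3), φ ((X - C ξ) ^ 3 * y) = 0 := by
  have hdvd (ξ : ℝ) {y : ℝ[X]} (hy : y ∈ P (n - 3)) : (T.apply v).denom ∣ cubeForm φ ξ y := by
    obtain ⟨h, -, e⟩ := exists_cubeForm_mul (by omega) hM hT hφ hv hv1 ξ hy
    exact (RatFunc.isCoprime_num_denom _).symm.dvd_of_dvd_mul_right
      ⟨h, by rw [mul_num_eq_mul_denom e, mul_comm]⟩
  have hdeg : (T.apply v).denom.degree ≠ 0 := fun h0 => by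
    have h1 : (T.apply v).denom = 1 :=
      (RatFunc.monic_denom _).natDegree_eq_zero.1 (natDegree_eq_of_degree_eq_some h0)
    refine hf (T.apply v).num ?_
    conv_lhs => rw [← RatFunc.num_div_denom (T.apply v), h1, map_one, div_one]
  obtain ⟨z, hz⟩ := IsAlgClosed.exists_aeval_eq_zero ℂ _ hdeg
  have hL : aeval z (X - C z.re) = z.im * Complex.I := by
    rw [map_sub, aeval_X, aeval_C, Complex.coe_algebraMap, sub_eq_iff_eq_add']
    exact (Complex.re_add_im z).symm
  have hzero : ∀ y ∈ P (n - 3),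
      φ ((X - C z.re) ^ 3 * y) = 3 * z.im ^ 2 * φ ((X - C z.re) * y) ∧
      z.im * (3 * φ ((X - C z.re) ^ 2 * y)) = z.im * (z.im ^ 2 * φ y) := fun y hy => by
    obtain ⟨c, hc⟩ := hdvd z.re hy
    have h0 : aeval z (cubeForm φ z.re y) = 0 := by rw [hc, map_mul, hz, zero_mul]
    generalize hL' : X - C z.re = L at hL ⊢
    simp only [cubeForm, hL', map_sub, map_add, map_mul, map_pow, aeval_C, map_ofNat, hL,
      Complex.coe_algebraMap] at h0
    have e : ((φ (L ^ 3 * y) - 3 * z.im ^ 2 * φ (L * y) : ℝ) : ℂ)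
        + ((z.im * (z.im ^ 2 * φ y) - z.im * (3 * φ (L ^ 2 * y)) : ℝ) : ℂ)
          * Complex.I = 0 := by
      push_cast
      linear_combination h0 + (-3 * (z.im : ℂ) ^ 2 * φ (L * y)
        + (z.im : ℂ) ^ 3 * Complex.I * φ y) * Complex.I_sq
    have hre := congrArg Complex.re e
    have him := congrArg Complex.im e
    simp only [Complex.add_re, Complex.add_im, Complex.ofReal_re, Complex.ofReal_im,
      Complex.re_ofReal_mul, Complex.im_ofReal_mul, Complex.I_re, Complex.I_im, mul_zero, mul_one,
      add_zero, zero_add, Complex.zero_re, Complex.zero_im] at hre him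
    exact ⟨by linarith, by linarith⟩
  have hη : z.im = 0 := by
    by_contra hη
    have := eq_zero_of_nonreal hn hη (fun y hy => (hzero y hy).1)
      (fun y hy => mul_left_cancel₀ hη (hzero y hy).2) v hv
    exact one_ne_zero (hv1.symm.trans this)
  refine ⟨z.re, ?_, fun y hy => ?_⟩
  · have hz' : z = ((z.re : ℝ) : ℂ) := Complex.ext rfl (by simp [hη])
    rw [hz', ← Complex.coe_algebraMap, aeval_algebraMap_apply] at hz
    simpa using hz
  · rw [(hzero y hy).1, hη]
    ring

/-- The functional `φ` has no second order term at a pole `ξ` of `T(v)`. -/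
theorem functional_sq_eq_zero_of_pole (hn : 5 ≤ n) (hM : M ≤ P n) (hT : T ∈ D2 M)
    (hφ : ∀ y ∈ P n, y ∈ M ↔ φ y = 0) (hv : v ∈ P n) (hv1 : φ v = 1) {ξ : ℝ}
    (hξ : (T.apply v).denom.IsRoot ξ) (h3 : ∀ y ∈ P (n - 3), φ ((X - C ξ) ^ 3 * y) = 0) :
    φ ((X - C ξ) ^ 2) = 0 := by
  obtain ⟨k, rfl⟩ := Nat.exists_eq_add_of_le' hn
  rw [show k + 5 - 3 = k + 2 by omega] at h3
  by_contra hc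
  have h1P : (1 : ℝ[X]) ∈ P k := mem_P.2 (by simp)
  have hpow (j : ℕ) (hj : j ≤ 5) : (X - C ξ) ^ j ∈ P (k + 5) := by
    simpa using P_mono (by omega) (X_sub_C_pow_mul_mem ξ j h1P)
  have hpow0 (j : ℕ) (hj : j ≤ 2) : φ ((X - C ξ) ^ (3 + j)) = 0 := by
    rw [pow_add]
    exact h3 _ (by simpa using P_mono (by omega) (X_sub_C_pow_mul_mem ξ j h1P))
  have h30 := hpow0 0 (by omega)
  have h40 := hpow0 1 (by omega)
  have h50 := hpow0 2 (by omega)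
  norm_num only at h30 h40 h50
  have cube (j : ℕ) (hj : j ≤ 2) := exists_cubeForm_mul (y := (X - C ξ) ^ j) (by omega) hM hT
    hφ hv hv1 ξ (by simpa using P_mono (by omega) (X_sub_C_pow_mul_mem ξ j h1P))
  obtain ⟨g₀, -, e₀⟩ := cube 0 (by omega)
  obtain ⟨g₁, -, e₁⟩ := cube 1 (by omega)
  obtain ⟨g₂, -, e₂⟩ := cube 2 (by omega)
  obtain ⟨m₀, -, t₀⟩ := exists_apply_eq hM hT hφ hv hv1 (hpow 0 (by omega))
  obtain ⟨m₁, -, t₁⟩ := exists_apply_eq hM hT hφ hv hv1 (hpow 1 (by omega))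
  obtain ⟨m₂, -, t₂⟩ := exists_apply_eq hM hT hφ hv hv1 (hpow 2 (by omega))
  obtain ⟨z, hz, t₅⟩ := hT _ ((hφ _ (hpow 5 le_rfl)).2 h50)
  have hz0 := (hφ z (hM hz)).1 hz
  have five := T.apply_pow_five ξ 1
  rw [mul_one, mul_one, mul_one, t₅] at five
  rw [pow_zero] at e₀ t₀
  rw [pow_one] at e₁ t₁
  -- The cubics attached to `1`, `L`, `L²`, where `L = X - C ξ`, are triangular in `L³`, `L²`, `L`
  -- with diagonal entries multiples of `φ(L²)`. So `L` is a combination of them, and the pole of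
  -- `T(v)` is simple.
  have hspan : C (1 / (3 * φ ((X - C ξ) ^ 2) ^ 3)) *
      (-C (φ ((X - C ξ) ^ 2) ^ 2) * cubeForm φ ξ 1
        + C (φ (X - C ξ) * φ ((X - C ξ) ^ 2)) * cubeForm φ ξ (X - C ξ)
        + C (φ 1 * φ ((X - C ξ) ^ 2) - φ (X - C ξ) ^ 2) * cubeForm φ ξ ((X - C ξ) ^ 2))
      = X - C ξ := by
    simp only [cubeForm]
    generalize X - C ξ = L at *
    have hCC : C (1 / (3 * φ (L ^ 2) ^ 3)) * C (3 * φ (L ^ 2) ^ 3) = 1 := by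
      rw [← C_mul, one_div_mul_cancel (by positivity), C_1]
    rw [← pow_add, ← pow_add, ← pow_succ', ← pow_succ, ← pow_succ, ← pow_two]
    simp only [mul_one, Nat.reduceAdd, h30, h40, h50, C_0, C_mul, C_pow, C_sub, C_ofNat] at hCC ⊢
    linear_combination L * hCC
  obtain ⟨W, hW⟩ : ∃ W : ℝ[X], algebraMap ℝ[X] (RatFunc ℝ) (X - C ξ) * T.apply v
      = algebraMap ℝ[X] (RatFunc ℝ) W := by
    refine ⟨C (1 / (3 * φ ((X - C ξ) ^ 2) ^ 3)) * (-C (φ ((X - C ξ) ^ 2) ^ 2) * g₀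
      + C (φ (X - C ξ) * φ ((X - C ξ) ^ 2)) * g₁
      + C (φ 1 * φ ((X - C ξ) ^ 2) - φ (X - C ξ) ^ 2) * g₂), ?_⟩
    rw [map_mul, map_add, map_add, map_mul _ _ g₀, map_mul _ _ g₁, map_mul _ _ g₂,
      ← e₀, ← e₁, ← e₂]
    conv_lhs => rw [← hspan]
    simp only [map_mul _ _ (cubeForm _ _ _), map_add, map_mul (algebraMap _ _) _ (_ + _)]
    ring
  have hWξ : W.eval ξ ≠ 0 := fun h0 => by
    obtain ⟨U, rfl⟩ := dvd_iff_isRoot.2 h0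
    have hnum := mul_num_eq_mul_denom hW
    rw [mul_assoc, mul_right_inj' (X_sub_C_ne_zero ξ)] at hnum
    have hunit : IsUnit (T.apply v).denom :=
      (RatFunc.isCoprime_num_denom (T.apply v)).isUnit_of_dvd' ⟨U, by rw [hnum, mul_comm]⟩ dvd_rfl
    exact not_isUnit_X_sub_C ξ (isUnit_of_dvd_unit (dvd_iff_isRoot.2 hξ) hunit)
  generalize hcd : φ ((X - C ξ) ^ 2) = c at *
  have hpoly : z = 10 * (X - C ξ) ^ 2 * ((X - C ξ) * m₂ + C c * W)
      - 15 * (X - C ξ) ^ 3 * ((X - C ξ) * m₁ + C (φ (X - C ξ)) * W)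
      + 6 * (X - C ξ) ^ 4 * ((X - C ξ) * m₀ + C (φ 1) * W) := by
    apply RatFunc.algebraMap_injective ℝ
    rw [five, t₀, t₁, t₂]
    simp only [map_add, map_sub (algebraMap _ _) (_ * _), map_mul, map_pow, map_ofNat, ← hW]
    ring
  obtain ⟨U, hU⟩ : X - C ξ ∣ W - C (W.eval ξ) := by
    rw [dvd_iff_isRoot, IsRoot, eval_sub, eval_C, sub_self]
  -- The leading term of `T(L⁵)` at `ξ` comes from `T(L²)`, which has the pole of `φ(L²) T(v)`.
  have hz3 : z = C (10 * c * W.eval ξ) * (X - C ξ) ^ 2 + (X - C ξ) ^ 3 *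
      (10 * (m₂ + C c * U) - 15 * ((X - C ξ) * m₁ + C (φ (X - C ξ)) * W)
      + 6 * (X - C ξ) * ((X - C ξ) * m₀ + C (φ 1) * W)) := by
    rw [hpoly, C_mul, C_mul, C_ofNat]
    linear_combination 10 * (X - C ξ) ^ 2 * C c * hU
  generalize (10 * (m₂ + C c * U) - 15 * ((X - C ξ) * m₁ + C (φ (X - C ξ)) * W)
      + 6 * (X - C ξ) * ((X - C ξ) * m₀ + C (φ 1) * W)) = K at hz3
  have hK : K ∈ P (k + 2) := by
    have h : (X - C ξ) ^ 3 * K ∈ P (k + 5) := by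
      rw [eq_sub_iff_add_eq'.2 hz3.symm, ← smul_eq_C_mul]
      exact sub_mem (hM hz) (Submodule.smul_mem _ _ (hpow 2 (by omega)))
    rw [mem_P] at h ⊢
    rcases eq_or_ne K 0 with rfl | hK0
    · simp
    · rw [natDegree_mul (pow_ne_zero 3 (X_sub_C_ne_zero ξ)) hK0, natDegree_pow,
        natDegree_X_sub_C] at h
      omega
  rw [hz3, map_add, functional_C_mul, h3 K hK, hcd] at hz0
  simp [hc, hWξ] at hz0

/-! ### A pole at infinity -/

/-- If `T(v)` is a polynomial of degree greater than `n`, then `φ` only depends on the two top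
coefficients. -/
theorem functional_eq_zero_of_polynomial {F : ℝ[X]} (hn : 5 ≤ n) (hM : M ≤ P n) (hT : T ∈ D2 M)
    (hφ : ∀ y ∈ P n, y ∈ M ↔ φ y = 0) (hv : v ∈ P n) (hv1 : φ v = 1)
    (hF : T.apply v = algebraMap ℝ[X] (RatFunc ℝ) F) (hFn : F ∉ P n) :
    ∀ y ∈ P (n - 2), φ y = 0 := by
  obtain ⟨k, rfl⟩ := Nat.exists_eq_add_of_le' hn
  rw [show k + 5 - 2 = k + 3 by omega]
  rw [mem_P, not_le] at hFn
  have hF0 : F ≠ 0 := by rintro rfl; simp at hFn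
  have hdeg {y : ℝ[X]} (hy : y ∈ P (k + 2)) (h0 : cubeForm φ 0 y ≠ 0) :
      (cubeForm φ 0 y).natDegree + F.natDegree ≤ k + 8 := by
    obtain ⟨h, hh, e⟩ := exists_cubeForm_mul (by omega) hM hT hφ hv hv1 0 hy
    rw [hF, ← map_mul] at e
    rw [← natDegree_mul h0 hF0, RatFunc.algebraMap_injective ℝ e]
    exact mem_P.1 hh
  have hcoeff (y : ℝ[X]) : (cubeForm φ 0 y).coeff 3 = -φ y ∧
      (cubeForm φ 0 y).coeff 2 = 3 * φ (X * y) := by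
    have : cubeForm φ 0 y = C (φ (X ^ 3 * y)) + C (-3 * φ (X ^ 2 * y)) * X
        + C (3 * φ (X * y)) * X ^ 2 + C (-φ y) * X ^ 3 := by
      simp only [cubeForm, C_0, sub_zero, C_mul, C_neg, C_ofNat]
      ring
    rw [this]
    constructor <;>
      simp [-map_mul, -map_neg, coeff_C_mul]
  -- The cubic forms have degree at most two, since `T(v)` has degree greater than `n`.
  have hlow : ∀ y ∈ P (k + 2), φ y = 0 := fun y hy => by
    by_contra h
    have h3 : (cubeForm φ 0 y).coeff 3 ≠ 0 := by rw [(hcoeff y).1]; exact neg_ne_zero.2 h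
    have := hdeg hy (fun h0 => h3 (by rw [h0, coeff_zero]))
    have := le_natDegree_of_ne_zero h3
    omega
  have htop {y : ℝ[X]} (hy : y ∈ P (k + 3)) : φ y = y.coeff (k + 3) * φ (X ^ (k + 3)) := by
    have : y - C (y.coeff (k + 3)) * X ^ (k + 3) ∈ P (k + 2) := by
      rw [mem_P, natDegree_le_iff_coeff_eq_zero]
      intro N hN
      rw [coeff_sub, coeff_C_mul_X_pow]
      split_ifs with h
      · rw [h, sub_self]
      · rw [sub_zero]
        exact coeff_eq_zero_of_natDegree_lt (lt_of_le_of_lt (mem_P.1 hy) (by omega))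
    have := hlow _ this
    rwa [map_sub, functional_C_mul, sub_eq_zero] at this
  suffices hc : φ (X ^ (k + 3)) = 0 by
    intro y hy
    rw [htop hy, hc, mul_zero]
  by_contra hc
  have hXP (j : ℕ) (hj : j ≤ 5) : (X : ℝ[X]) ^ (k + j) ∈ P (k + 5) :=
    mem_P.2 (by rw [natDegree_X_pow]; omega)
  -- The cubic attached to `X ^ (n - 3)` has degree two, which bounds the degree of `T(v)`.
  have hF6 : F.natDegree = k + 6 := by
    have hy : (X : ℝ[X]) ^ (k + 2) ∈ P (k + 2) := mem_P.2 (by rw [natDegree_X_pow])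
    have h2 : (cubeForm φ 0 (X ^ (k + 2))).coeff 2 ≠ 0 := by
      rw [(hcoeff _).2, ← pow_succ']
      exact mul_ne_zero (by norm_num) hc
    have := hdeg hy (fun h0 => h2 (by rw [h0, coeff_zero]))
    have := le_natDegree_of_ne_zero h2
    omega
  obtain ⟨m₃, d₃, t₃⟩ := exists_apply_eq hM hT hφ hv hv1 (hXP 3 (by omega))
  obtain ⟨m₄, d₄, t₄⟩ := exists_apply_eq hM hT hφ hv hv1 (hXP 4 (by omega))
  obtain ⟨m₅, d₅, t₅⟩ := exists_apply_eq hM hT hφ hv hv1 (hXP 5 (by omega))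
  obtain ⟨z, hz, t₀⟩ := hT (X ^ k) ((hφ _ (hXP 0 (by omega))).2
    (hlow _ (mem_P.2 (by rw [natDegree_X_pow]; omega))))
  have hz0 := (hφ z (hM hz)).1 hz
  have five := T.pow_five_mul_apply 0 (X ^ k)
  simp only [C_0, sub_zero, ← pow_add, add_comm _ k] at five
  rw [t₃, t₄, t₅, t₀, hF] at five
  generalize hcd : φ (X ^ (k + 3)) = c at *
  generalize φ (X ^ (k + 4)) = b at *
  generalize φ (X ^ (k + 5)) = a at *
  have hpoly : X ^ 5 * z = C 6 * (m₅ + C a * F) - C 15 * X * (m₄ + C b * F)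
      + C 10 * X ^ 2 * (m₃ + C c * F) := by
    apply RatFunc.algebraMap_injective ℝ
    simp only [map_add, map_sub, map_mul, map_pow, map_ofNat] at five ⊢
    exact five
  rw [mem_P] at d₃ d₄ d₅
  have hF' (j : ℕ) (hj : k + 6 < j) : F.coeff j = 0 :=
    coeff_eq_zero_of_natDegree_lt (by omega)
  -- The top coefficient of `T(X ^ (n - 5))` comes from `T(X ^ (n - 2))`.
  have hcz (j : ℕ) (hj : k + 3 ≤ j) : z.coeff j = 10 * c * F.coeff (j + 3) := by
    have := congrArg (fun p => coeff p (j + 5)) hpoly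
    simp only [coeff_X_pow_mul, coeff_add, coeff_sub, coeff_C_mul, mul_assoc] at this
    rw [show j + 5 = j + 4 + 1 by omega, coeff_X_mul, show j + 4 + 1 = j + 3 + 2 by omega,
      coeff_add, coeff_C_mul] at this
    rw [this, coeff_eq_zero_of_natDegree_lt (p := m₅) (by omega),
      coeff_eq_zero_of_natDegree_lt (p := m₄) (by omega),
      coeff_eq_zero_of_natDegree_lt (p := m₃) (by omega), hF' (j + 3 + 2) (by omega),
      hF' (j + 4) (by omega)]
    ring
  have hzd : z ∈ P (k + 3) := by
    rw [mem_P, natDegree_le_iff_coeff_eq_zero]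
    intro N hN
    rw [hcz N hN.le, hF' _ (by omega), mul_zero]
  rw [htop hzd, hcz _ le_rfl, show k + 3 + 3 = F.natDegree by omega] at hz0
  simp [hc, hF0] at hz0

/-! ### Exceptional hyperplanes are first order jets -/

theorem eq_affine_jet {ξ : ℝ} (hn : 3 ≤ n) (h2 : φ ((X - C ξ) ^ 2) = 0)
    (h3 : ∀ y ∈ P (n - 3), φ ((X - C ξ) ^ 3 * y) = 0) {y : ℝ[X]} (hy : y ∈ P n) :
    φ y = φ 1 * y.eval ξ + φ (X - C ξ) * (derivative y).eval ξ := by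
  obtain ⟨k, rfl⟩ := Nat.exists_eq_add_of_le' hn
  rw [Nat.add_sub_cancel] at h3
  obtain ⟨u, hu, e⟩ := exists_eq_C_add_mul ξ hy
  obtain ⟨w, hw, e'⟩ := exists_eq_C_add_mul ξ hu
  obtain ⟨z, hz, e''⟩ := exists_eq_C_add_mul ξ hw
  have hd : (derivative y).eval ξ = u.eval ξ := by
    rw [e]
    simp
  have : y = C (y.eval ξ) * 1 + C (u.eval ξ) * (X - C ξ) + C (w.eval ξ) * (X - C ξ) ^ 2
      + (X - C ξ) ^ 3 * z := by
    conv_lhs => rw [e, e', e'']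
    ring
  rw [hd]
  conv_lhs => rw [this]
  rw [map_add, map_add, map_add, functional_C_mul, functional_C_mul, functional_C_mul, h2, h3 z hz]
  ring

theorem eq_jet_infinity (hn : 2 ≤ n) (h : ∀ y ∈ P (n - 2), φ y = 0) {y : ℝ[X]} (hy : y ∈ P n) :
    φ y = φ (X ^ n) * y.coeff n + φ (X ^ (n - 1)) * y.coeff (n - 1) := by
  have : y - (C (y.coeff n) * X ^ n + C (y.coeff (n - 1)) * X ^ (n - 1)) ∈ P (n - 2) := by
    rw [mem_P, natDegree_le_iff_coeff_eq_zero]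
    intro N hN
    rw [coeff_sub, coeff_add, coeff_C_mul_X_pow, coeff_C_mul_X_pow]
    rcases lt_trichotomy N n with h | rfl | h
    · obtain rfl : N = n - 1 := by omega
      rw [if_neg (by omega), if_pos rfl, zero_add, sub_self]
    · rw [if_pos rfl, if_neg (by omega), add_zero, sub_self]
    · rw [if_neg (by omega), if_neg (by omega), add_zero, sub_zero]
      exact coeff_eq_zero_of_natDegree_lt (lt_of_le_of_lt (mem_P.1 hy) h)
  have := h _ this
  rw [map_sub, map_add, functional_C_mul, functional_C_mul] at this
  linarith

/-- The functional defining an exceptional hyperplane is a jet of order at most one at a point of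
the real projective line. -/
theorem IsExceptional.exists_jet (hn : 5 ≤ n) (hM : M ≤ P n) (hd : Module.finrank ℝ M = n)
    (hexc : IsExceptional n M) :
    ∃ (φ : ℝ[X] →ₗ[ℝ] ℝ) (v : ℝ[X]), v ∈ P n ∧ φ v = 1 ∧ (∀ y ∈ P n, y ∈ M ↔ φ y = 0) ∧
      ((∃ ξ : ℝ, ∀ y ∈ P n, φ y = φ 1 * y.eval ξ + φ (X - C ξ) * (derivative y).eval ξ) ∨
        ∀ y ∈ P n, φ y = φ (X ^ n) * y.coeff n + φ (X ^ (n - 1)) * y.coeff (n - 1)) := by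
  obtain ⟨T, hT, hTn⟩ := SetLike.not_le_iff_exists.1 hexc
  have : ∃ v ∈ P n, ¬ ∃ z ∈ P n, T.apply v = algebraMap ℝ[X] (RatFunc ℝ) z := by
    by_contra! h
    exact hTn h
  obtain ⟨v, hv, hvT⟩ := this
  have hvM : v ∉ M := fun h => by
    obtain ⟨z, hz, e⟩ := hT v h
    exact hvT ⟨z, hM hz, e⟩
  obtain ⟨φ, hv1, hφ⟩ := exists_functional hM hd hv hvM
  refine ⟨φ, v, hv, hv1, hφ, ?_⟩
  by_cases hf : ∃ F : ℝ[X], T.apply v = algebraMap ℝ[X] (RatFunc ℝ) F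
  · obtain ⟨F, hF⟩ := hf
    exact .inr fun y hy => eq_jet_infinity (by omega)
      (functional_eq_zero_of_polynomial hn hM hT hφ hv hv1 hF fun h => hvT ⟨F, h, hF⟩) hy
  · obtain ⟨ξ, hξ, h3⟩ := exists_real_pole hn hM hT hφ hv hv1 (not_exists.1 hf)
    exact .inl ⟨ξ, fun y hy => eq_affine_jet (by omega)
      (functional_sq_eq_zero_of_pole hn hM hT hφ hv hv1 hξ h3) h3 hy⟩

/-! ### Projective equivalences -/

theorem slAct_apply (n : ℕ) (A : Matrix.SpecialLinearGroup (Fin 2) ℝ) (y : ℝ[X]) :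
    slAct n A y = ∑ k ∈ Finset.range (n + 1), C (y.coeff k) *
      ((C (A.1 0 0) * X + C (A.1 0 1)) ^ k * (C (A.1 1 0) * X + C (A.1 1 1)) ^ (n - k)) := by
  simp [slAct, LinearMap.sum_apply, smul_eq_C_mul]

/-- The matrix with rows `(α, β)` and `(γ, δ)` as an element of `SL(2, ℝ)`. -/
def slMatrix (α β γ δ : ℝ) (h : α * δ - β * γ = 1) : Matrix.SpecialLinearGroup (Fin 2) ℝ :=
  ⟨!![α, β; γ, δ], by rw [Matrix.det_fin_two_of, h]⟩

theorem slAct_slMatrix (n : ℕ) {α β γ δ : ℝ} (h : α * δ - β * γ = 1) (y : ℝ[X]) :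
    slAct n (slMatrix α β γ δ h) y = ∑ k ∈ Finset.range (n + 1), C (y.coeff k) *
      ((C α * X + C β) ^ k * (C γ * X + C δ) ^ (n - k)) :=
  slAct_apply n _ y

theorem slAct_mem (n : ℕ) (A : Matrix.SpecialLinearGroup (Fin 2) ℝ) (y : ℝ[X]) :
    slAct n A y ∈ P n := by
  rw [slAct_apply]
  refine Submodule.sum_mem _ fun k hk => ?_
  rw [← smul_eq_C_mul]
  refine Submodule.smul_mem _ _ (mem_P.2 ?_)
  have hk' := Finset.mem_range.1 hk
  calc _ ≤ k * 1 + (n - k) * 1 := natDegree_mul_le_of_le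
        (natDegree_pow_le_of_le k natDegree_linear_le)
        (natDegree_pow_le_of_le _ natDegree_linear_le)
    _ = n := by omega

/-- The projective action is injective on `P n`: each `t` with `γ t ≠ α` is the image of
`x = (δ t - β) / (α - γ t)`, so `slAct n A y = 0` forces `(α - γ X) y = 0`. -/
theorem slAct_eq_zero {A : Matrix.SpecialLinearGroup (Fin 2) ℝ} {y : ℝ[X]} (hy : y ∈ P n)
    (h : slAct n A y = 0) : y = 0 := by
  have hdet : A.1 0 0 * A.1 1 1 - A.1 0 1 * A.1 1 0 = 1 := by
    rw [← Matrix.det_fin_two]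
    exact A.2
  have hprod : (C (A.1 0 0) - C (A.1 1 0) * X) * y = 0 := by
    refine Polynomial.funext fun t => ?_
    simp only [eval_mul, eval_sub, eval_C, eval_X, eval_zero]
    by_cases ht : A.1 0 0 - A.1 1 0 * t = 0
    · rw [ht, zero_mul]
    · have hden : A.1 1 0 * ((A.1 1 1 * t - A.1 0 1) / (A.1 0 0 - A.1 1 0 * t)) + A.1 1 1
          = 1 / (A.1 0 0 - A.1 1 0 * t) := by
        field_simp
        linear_combination hdet
      have hnum : A.1 0 0 * ((A.1 1 1 * t - A.1 0 1) / (A.1 0 0 - A.1 1 0 * t)) + A.1 0 1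
          = t / (A.1 0 0 - A.1 1 0 * t) := by
        rw [mul_div_assoc', div_add' _ _ _ ht, div_left_inj' ht]
        linear_combination t * hdet
      have hne : 1 / (A.1 0 0 - A.1 1 0 * t) ≠ 0 := one_div_ne_zero ht
      have := eval_slAct n A y hy _ (hden ▸ hne)
      rw [h, eval_zero, hden, hnum, div_div_div_cancel_right₀ ht, div_one] at this
      rw [(mul_eq_zero.1 this.symm).resolve_left (pow_ne_zero n hne), mul_zero]
  refine (mul_eq_zero.1 hprod).resolve_left fun h0 => ?_
  have h00 := congrArg (coeff · 0) h0
  have h10 := congrArg (coeff · 1) h0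
  simp at h00 h10
  simp [h00, h10] at hdet

theorem map_slAct_eq {N : Submodule ℝ ℝ[X]} [FiniteDimensional ℝ N]
    {A : Matrix.SpecialLinearGroup (Fin 2) ℝ} (hM : M ≤ P n) (hd : Module.finrank ℝ M = n)
    (hN : Module.finrank ℝ N ≤ n) (h : ∀ y ∈ M, slAct n A y ∈ N) : M.map (slAct n A) = N := by
  refine Submodule.eq_of_le_of_finrank_le (Submodule.map_le_iff_le_comap.2 h) ?_
  have hinj : Function.Injective ((slAct n A).domRestrict M) := by
    rw [← LinearMap.ker_eq_bot, LinearMap.ker_eq_bot']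
    exact fun y hy => Subtype.ext (slAct_eq_zero (hM y.2) hy)
  rw [← LinearMap.range_domRestrict, LinearMap.finrank_range_of_inj hinj, hd]
  exact hN

theorem eq_sum_of_mem_P {y : ℝ[X]} (hy : y ∈ P n) :
    y = ∑ k ∈ Finset.range (n + 1), C (y.coeff k) * X ^ k :=
  as_sum_range_C_mul_X_pow' y (Nat.lt_succ_of_le (mem_P.1 hy))

theorem E_eq_span (n : ℕ) : E n = Submodule.span ℝ
    ((insert (X + 1) ((Finset.Icc 2 n).image (fun k : ℕ => (X : ℝ[X]) ^ k)) : Finset ℝ[X]) :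
      Set ℝ[X]) := by
  simp [E]

instance finiteDimensional_E (n : ℕ) : FiniteDimensional ℝ (E n) := by
  rw [E_eq_span]
  infer_instance

theorem finrank_E_le (hn : 1 ≤ n) : Module.finrank ℝ (E n) ≤ n := by
  rw [E_eq_span]
  refine (finrank_span_finset_le_card _).trans ((Finset.card_insert_le _ _).trans ?_)
  have := Finset.card_image_le (s := Finset.Icc 2 n) (f := fun k : ℕ => (X : ℝ[X]) ^ k)
  rw [Nat.card_Icc] at this
  omega

theorem mem_E (hn : 1 ≤ n) {y : ℝ[X]} (hy : y ∈ P n) (h : y.coeff 0 = y.coeff 1) : y ∈ E n := by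
  obtain ⟨k, rfl⟩ := Nat.exists_eq_add_of_le' hn
  have : y = y.coeff 1 • (X + 1)
      + ∑ i ∈ Finset.range k, y.coeff (i + 1 + 1) • (X : ℝ[X]) ^ (i + 1 + 1) := by
    conv_lhs => rw [eq_sum_of_mem_P hy, Finset.sum_range_succ', Finset.sum_range_succ', h]
    simp only [smul_eq_C_mul]
    ring
  rw [this]
  refine add_mem (Submodule.smul_mem _ _ (Submodule.subset_span (Set.mem_insert _ _)))
    (Submodule.sum_mem _ fun i hi => Submodule.smul_mem _ _ (Submodule.subset_span
      (Set.mem_insert_of_mem _ ⟨_, ?_, rfl⟩)))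
  have := Finset.mem_range.1 hi
  exact ⟨by omega, by omega⟩

theorem mem_P_pred (hn : 1 ≤ n) {y : ℝ[X]} (hy : y ∈ P n) (h : y.coeff n = 0) : y ∈ P (n - 1) := by
  rw [mem_P, natDegree_le_iff_coeff_eq_zero]
  intro N hN
  rcases eq_or_ne N n with rfl | hne
  · exact h
  · exact coeff_eq_zero_of_natDegree_lt (lt_of_le_of_lt (mem_P.1 hy) (by omega))

/-- The transformation used sends infinity to `ξ`. -/
theorem projEquiv_P_pred_of_eval (hn : 1 ≤ n) (hM : M ≤ P n) (hd : Module.finrank ℝ M = n)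
    {ξ : ℝ} (h : ∀ y ∈ M, y.eval ξ = 0) : ProjEquiv n M (P (n - 1)) := by
  refine ⟨slMatrix ξ (-1) 1 0 (by ring),
    map_slAct_eq hM hd (by rw [finrank_P]; omega) fun y hy =>
      mem_P_pred hn (slAct_mem _ _ _) (Eq.trans ?_ (h y hy))⟩
  rw [slAct_slMatrix, finsetSum_coeff,
    eval_eq_sum_range' (Nat.lt_succ_of_le (mem_P.1 (hM hy)))]
  refine Finset.sum_congr rfl fun k hk => ?_
  have hk' := Finset.mem_range.1 hk
  have hc := coeff_pow_of_natDegree_le (m := k) (natDegree_linear_le (a := ξ) (b := -1))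
  rw [mul_one] at hc
  obtain ⟨d, rfl⟩ := Nat.exists_eq_add_of_le (Nat.lt_succ_iff.1 hk')
  simp only [C_1, one_mul, C_0, add_zero, Nat.add_sub_cancel_left, coeff_C_mul,
    coeff_mul_X_pow, hc]
  simp [coeff_one]

theorem projEquiv_P_pred_of_coeff (hn : 1 ≤ n) (hM : M ≤ P n) (hd : Module.finrank ℝ M = n)
    (h : ∀ y ∈ M, y.coeff n = 0) : ProjEquiv n M (P (n - 1)) := by
  refine ⟨1, map_slAct_eq hM hd (by rw [finrank_P]; omega) fun y hy => ?_⟩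
  have : slAct n 1 y = y := by
    conv_rhs => rw [eq_sum_of_mem_P (hM hy)]
    simp [slAct_apply]
  rw [this]
  exact mem_P_pred hn (hM hy) (h y hy)

/-- The transformation `x ↦ ((1 + ξ γ) x + ξ) / (γ x + 1)` sends `0` to `ξ`; its weight adds
`n γ y(ξ)` to the derivative at `0`, and `γ` is chosen so that the jet becomes `y(0) = y'(0)`. -/
theorem projEquiv_E_of_eval (hn : 1 ≤ n) (hM : M ≤ P n) (hd : Module.finrank ℝ M = n)
    {ξ c : ℝ} (h : ∀ y ∈ M, (derivative y).eval ξ = c * y.eval ξ) : ProjEquiv n M (E n) := by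
  have hn0 : (n : ℝ) ≠ 0 := by positivity
  obtain ⟨γ, hγ⟩ : ∃ γ : ℝ, c + n * γ = 1 := ⟨(1 - c) / n, by field_simp; ring⟩
  refine ⟨slMatrix (1 + ξ * γ) ξ γ 1 (by ring),
    map_slAct_eq hM hd (finrank_E_le hn) fun y hy => mem_E hn (slAct_mem _ _ _) ?_⟩
  have hy' := eq_sum_of_mem_P (hM hy)
  have e0 : y.eval ξ = ∑ k ∈ Finset.range (n + 1), y.coeff k * ξ ^ k := by
    conv_lhs => rw [hy']
    simp [eval_finsetSum]
  have e1 : (derivative y).eval ξ =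
      ∑ k ∈ Finset.range (n + 1), y.coeff k * (k * ξ ^ (k - 1)) := by
    conv_lhs => rw [hy']
    simp [eval_finsetSum, derivative_X_pow]
  have hc1 (p : ℝ[X]) : p.coeff 1 = (derivative p).eval 0 := by
    rw [← coeff_zero_eq_eval_zero, coeff_derivative]
    simp
  rw [coeff_zero_eq_eval_zero, hc1, slAct_slMatrix, derivative_sum, eval_finsetSum, eval_finsetSum]
  have r0 : ∑ k ∈ Finset.range (n + 1), eval 0 (C (y.coeff k) *
      ((C (1 + ξ * γ) * X + C ξ) ^ k * (C γ * X + C 1) ^ (n - k))) = y.eval ξ := by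
    rw [e0]
    simp
  have r1 : ∑ k ∈ Finset.range (n + 1), eval 0 (derivative (C (y.coeff k) *
      ((C (1 + ξ * γ) * X + C ξ) ^ k * (C γ * X + C 1) ^ (n - k))))
      = (derivative y).eval ξ + n * γ * y.eval ξ := by
    rw [e0, e1, Finset.mul_sum, ← Finset.sum_add_distrib]
    refine Finset.sum_congr rfl fun k hk => ?_
    have hk' := Nat.lt_succ_iff.1 (Finset.mem_range.1 hk)
    simp [derivative_mul, derivative_pow, Nat.cast_sub hk']
    rcases k with _ | k
    · simp; ring
    · simp; ring
  rw [r0, r1, h y hy, ← add_mul, hγ, one_mul]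

/-- The transformation `x ↦ (α x - 1) / x` sends `0` to infinity, and `α` normalizes the jet. -/
theorem projEquiv_E_of_coeff (hn : 1 ≤ n) (hM : M ≤ P n) (hd : Module.finrank ℝ M = n)
    {c : ℝ} (h : ∀ y ∈ M, y.coeff (n - 1) = c * y.coeff n) : ProjEquiv n M (E n) := by
  have hn0 : (n : ℝ) ≠ 0 := by positivity
  obtain ⟨α, hα⟩ : ∃ α : ℝ, c + n * α = -1 := ⟨(-1 - c) / n, by field_simp; ring⟩
  refine ⟨slMatrix α (-1) 1 0 (by ring),
    map_slAct_eq hM hd (finrank_E_le hn) fun y hy => mem_E hn (slAct_mem _ _ _) ?_⟩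
  have hy' := h y hy
  obtain ⟨m, rfl⟩ := Nat.exists_eq_add_of_le' hn
  rw [slAct_slMatrix, finsetSum_coeff, finsetSum_coeff]
  simp only [C_1, one_mul, C_0, add_zero, coeff_C_mul, coeff_mul_X_pow']
  rw [Finset.sum_range_succ, Finset.sum_range_succ, Finset.sum_range_succ, Finset.sum_range_succ,
    Finset.sum_eq_zero, Finset.sum_eq_zero]
  · have hc1 (p : ℝ[X]) : p.coeff 1 = (derivative p).eval 0 := by
      rw [← coeff_zero_eq_eval_zero, coeff_derivative]
      simp
    rw [Nat.add_sub_cancel] at hy'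
    simp [hc1, hy', coeff_zero_eq_eval_zero, derivative_pow]
    push_cast at hα
    linear_combination (-1) ^ m * y.coeff (m + 1) * (-hα)
  · intro k hk
    have := Finset.mem_range.1 hk
    rw [if_neg (by omega), mul_zero]
  · intro k hk
    have := Finset.mem_range.1 hk
    rw [if_neg (by omega), mul_zero]

/-! ### The fundamental covariant -/

/-- The functional sending `y` to the determinant whose rows are the coefficients of the `p i` and
then those of `y`. -/
noncomputable def detFunctional (n : ℕ) (p : Fin n → ℝ[X]) : ℝ[X] →ₗ[ℝ] ℝ :=
  (Matrix.detRowAlternating.toMultilinearMap.toLinearMap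
    (Fin.snoc (α := fun _ => Fin (n + 1) → ℝ) (fun i j => (p i).coeff j) 0) (Fin.last n)) ∘ₗ
    LinearMap.pi fun j : Fin (n + 1) => lcoeff ℝ (j : ℕ)

theorem detFunctional_apply (p : Fin n → ℝ[X]) (y : ℝ[X]) :
    detFunctional n p y = Matrix.det (Matrix.of (Fin.snoc (α := fun _ => Fin (n + 1) → ℝ)
      (fun i j => (p i).coeff j) (fun j => y.coeff j))) := by
  simp only [detFunctional, LinearMap.comp_apply, MultilinearMap.toLinearMap_apply,
    Fin.update_snoc_last]
  rfl

theorem detFunctional_basis (p : Fin n → ℝ[X]) (i : Fin n) : detFunctional n p (p i) = 0 := by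
  rw [detFunctional_apply]
  refine Matrix.det_zero_of_row_eq (Fin.castSucc_lt_last i).ne ?_
  ext j
  simp

/-- The functional `detFunctional n p` vanishes on the span of `p`, hence is a multiple of `φ`. -/
theorem detFunctional_eq_mul (p : Module.Basis (Fin n) ℝ M) (hφ : ∀ y ∈ P n, y ∈ M ↔ φ y = 0)
    (hv : v ∈ P n) (hv1 : φ v = 1) {y : ℝ[X]} (hy : y ∈ P n) :
    detFunctional n (fun i => (p i : ℝ[X])) y
      = φ y * detFunctional n (fun i => (p i : ℝ[X])) v := by
  have hM : ∀ m : M, detFunctional n (fun i => (p i : ℝ[X])) m = 0 := fun m => by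
    have : (detFunctional n (fun i => (p i : ℝ[X]))) ∘ₗ M.subtype = 0 :=
      p.ext fun i => detFunctional_basis _ i
    exact LinearMap.congr_fun this m
  have hz : y - φ y • v ∈ M :=
    (hφ _ (sub_mem hy (Submodule.smul_mem _ _ hv))).2 (by simp [hv1])
  have := hM ⟨_, hz⟩
  rwa [map_sub, map_smul, smul_eq_mul, sub_eq_zero] at this

theorem coeff_C_sub_X_pow (n j : ℕ) (x : ℝ) :
    ((C x - X) ^ n).coeff j = (-1) ^ j * n.choose j * x ^ (n - j) := by
  have : (C x - X) ^ n = C ((-1) ^ n) * (X + C (-x)) ^ n := by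
    rw [C_pow, ← mul_pow, C_neg, C_neg, C_1]
    ring
  rw [this, coeff_C_mul, coeff_X_add_C_pow]
  rcases le_or_gt j n with hj | hj
  · obtain ⟨d, rfl⟩ := Nat.exists_eq_add_of_le hj
    rw [Nat.add_sub_cancel_left, neg_pow x, pow_add]
    have : ((-1 : ℝ) ^ d) * (-1) ^ d = 1 := by rw [← mul_pow]; simp
    linear_combination (-1 : ℝ) ^ j * x ^ d * (j + d).choose j * this
  · simp [Nat.choose_eq_zero_of_lt hj]

theorem C_sub_X_pow_mem (n : ℕ) (x : ℝ) : (C x - X) ^ n ∈ P n := by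
  rw [mem_P]
  have h : (C x - X : ℝ[X]).natDegree ≤ 1 :=
    natDegree_sub_le_of_le ((natDegree_C x).trans_le zero_le_one) natDegree_X_le
  simpa using natDegree_pow_le_of_le n h

theorem eval_covariant (p : Fin n → ℝ[X]) (x : ℝ) :
    (covariant n p).eval x = detFunctional n p ((C x - X) ^ n) := by
  rw [covariant, detFunctional_apply, ← coe_evalRingHom, RingHom.map_det]
  congr 1
  ext i j
  induction i using Fin.lastCases with
  | last =>
    simp [coeff_C_sub_X_pow]
  | cast i => simp

/-- A first order jet at `ξ` applied to `(x - t)^n` is divisible by `(x - ξ)^(n - 1)`. The zero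
polynomial is excluded by the condition at infinity, since its `natDegree` is `0`. -/
theorem not_rootMultLE_of_jet (hn : 5 ≤ n) {q : ℝ[X]} {κ a b ξ : ℝ}
    (h : ∀ x, q.eval x = κ * (a * ((C x - X) ^ n).eval ξ
      + b * (derivative ((C x - X) ^ n)).eval ξ)) : ¬ RootMultLE n (n - 2) q := by
  rintro ⟨h1, h2⟩
  rcases eq_or_ne q 0 with rfl | hq
  · simp at h2
    omega
  · have hfac : q = (X - C ξ) ^ (n - 1) * (C κ * (C a * (X - C ξ) - C (b * n))) := by
      refine Polynomial.funext fun x => ?_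
      rw [h]
      obtain ⟨m, rfl⟩ := Nat.exists_eq_add_of_le' (show 1 ≤ n by omega)
      simp [derivative_pow]
      ring
    have := (le_rootMultiplicity_iff hq).2 ⟨_, hfac⟩
    have := h1 ξ
    omega

/-- A first order jet at infinity applied to `(x - t)^n` has degree at most one in `x`. -/
theorem not_rootMultLE_of_jet_infinity (hn : 5 ≤ n) {q : ℝ[X]} {κ a b : ℝ}
    (h : ∀ x, q.eval x = κ * (a * ((C x - X) ^ n).coeff n
      + b * ((C x - X) ^ n).coeff (n - 1))) : ¬ RootMultLE n (n - 2) q := by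
  rintro ⟨-, h2⟩
  have hlin : q = C (-κ * b * (-1) ^ n * n) * X + C (κ * a * (-1) ^ n) := by
    refine Polynomial.funext fun x => ?_
    obtain ⟨m, rfl⟩ := Nat.exists_eq_add_of_le' (show 1 ≤ n by omega)
    rw [h, coeff_C_sub_X_pow, coeff_C_sub_X_pow]
    simp
    ring
  have : q.natDegree ≤ 1 := hlin ▸ natDegree_linear_le
  omega

end Exceptional

theorem theorem1p3 (n : ℕ) (hn : 5 ≤ n) (M : Submodule ℝ (Polynomial ℝ))
    (hM : M ≤ Exceptional.P n) (hcodim : Module.finrank ℝ M = n) :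
    (Exceptional.IsExceptional n M →
      ¬ Exceptional.ProjEquiv n M (Exceptional.P (n - 1)) →
      Exceptional.ProjEquiv n M (Exceptional.E n)) ∧
    (∀ p : Module.Basis (Fin n) ℝ M,
      Exceptional.RootMultLE n (n - 2)
        (Exceptional.covariant n (fun i => (p i : Polynomial ℝ))) →
      Exceptional.D2 M ≤ Exceptional.D2 (Exceptional.P n)) := by
  open Exceptional in
  have hn1 : 1 ≤ n := by omega
  refine ⟨fun hexc hP => ?_, fun p hroot => ?_⟩
  · obtain ⟨φ, v, hv, hv1, hφ, ⟨ξ, hjet⟩ | hjet⟩ := hexc.exists_jet hn hM hcodim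
    · have hy0 := fun y (hy : y ∈ M) => (hjet y (hM hy)).symm.trans ((hφ y (hM hy)).1 hy)
      by_cases hb : φ (X - C ξ) = 0
      · refine absurd (projEquiv_P_pred_of_eval hn1 hM hcodim (ξ := ξ) fun y hy => ?_) hP
        have ha : φ 1 ≠ 0 := fun ha => by
          have := hjet v hv
          rw [hv1, ha, hb] at this
          simp at this
        have := hy0 y hy
        rw [hb, zero_mul, add_zero] at this
        exact (mul_eq_zero.1 this).resolve_left ha
      · refine projEquiv_E_of_eval hn1 hM hcodim (ξ := ξ) (c := -φ 1 / φ (X - C ξ))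
          fun y hy => ?_
        have := hy0 y hy
        field_simp
        linarith
    · have hy0 := fun y (hy : y ∈ M) => (hjet y (hM hy)).symm.trans ((hφ y (hM hy)).1 hy)
      by_cases hb : φ (X ^ (n - 1)) = 0
      · refine absurd (projEquiv_P_pred_of_coeff hn1 hM hcodim fun y hy => ?_) hP
        have ha : φ (X ^ n) ≠ 0 := fun ha => by
          have := hjet v hv
          rw [hv1, ha, hb] at this
          simp at this
        have := hy0 y hy
        rw [hb, zero_mul, add_zero] at this
        exact (mul_eq_zero.1 this).resolve_left ha
      · refine projEquiv_E_of_coeff hn1 hM hcodim (c := -φ (X ^ n) / φ (X ^ (n - 1)))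
          fun y hy => ?_
        have := hy0 y hy
        field_simp
        linarith
  · by_contra hexc
    obtain ⟨φ, v, hv, hv1, hφ, hjet⟩ := IsExceptional.exists_jet hn hM hcodim hexc
    have hq (x : ℝ) := (eval_covariant (fun i => (p i : ℝ[X])) x).trans
      ((detFunctional_eq_mul p hφ hv hv1 (C_sub_X_pow_mem n x)).trans (mul_comm _ _))
    rcases hjet with ⟨ξ, hjet⟩ | hjet
    · exact not_rootMultLE_of_jet hn (fun x => by
        rw [hq, hjet _ (C_sub_X_pow_mem n x)]) hroot
    · exact not_rootMultLE_of_jet_infinity hn (fun x => by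
        rw [hq, hjet _ (C_sub_X_pow_mem n x)]) hroot
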